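/- Let $n\ge 1$ and let $f\in C([0,1]^n)$ be nonnegative. Write $a_+=\max(a,0)$ and consider the equation $$\text{(P3)}\qquad \prod_{i=1}^n (w+n x_i w_{x_i})_+ = f \quad\text{on } (0,1]^n .$$ A function $w:(0,1]^n\to\mathbb R$ is a viscosity subsolution (resp. supersolution) of an equation $H(x,w,Dw)=0$ on $(0,1]^n$ if for every $x\in(0,1]^n$ and every $\varphi\in C^1((0,1]^n)$ such that $w-\varphi$ has a local maximum (resp. minimum) at $x$ relative to $(0,1]^n$ one has $H(x,w(x),D\varphi(x))\le 0$ (resp. $\ge 0$); it is a viscosity solution if it is both. It satisfies $H(x,w,Dw)\geq 0$ in the viscosity sense if it is a viscosity supersolution of $H=0$. Subsolutions are taken upper semicontinuous and supersolutions lower semicontinuous. (a) Let $w_1\in \mathrm{USC}((0,1]^n)$ be a bounded viscosity subsolution of (P3) and $w_2\in\mathrm{LSC}((0,1]^n)$ a bounded viscosity supersolution of (P3), and suppose that for every $i\in\{1,\dots,n\}$ $$(\ast)\qquad w_2+n x_i\,(w_2)_{x_i}\ge 0\quad\text{on }(0,1]^n$$ in the viscosity sense. Then $w_1\le w_2$ on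 $(0,1]^n$. (b) Consequently the maximal bounded solution is characterized without a boundary condition: let $u\in C([0,1]^n)$ be a nondecreasing (in each variable) viscosity solution of $\prod_{i=1}^n (u_{x_i})_+=f$ in $(0,1]^n$ with $u=0$ on $\Gamma=\partial[0,1]^n\setminus(0,1]^n$, and put $w(x)=u(x)/\big(n(x_1\cdots x_n)^{1/n}\big)$ on $(0,1]^n$. Then $w$ is a bounded viscosity solution of (P3) satisfying $(\ast)$ for every $i$, it is the only function with these properties, and every bounded viscosity solution of (P3) is $\le w$ on $(0,1]^n$. -/

import Mathlib

open Set

noncomputable section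

namespace Nondominated

/-- The half-open cube `(0,1]^n`. -/
def halfOpenCube (n : ℕ) : Set (Fin n → ℝ) := {x | ∀ i, 0 < x i ∧ x i ≤ 1}

/-- The closed cube `[0,1]^n`. -/
def closedCube (n : ℕ) : Set (Fin n → ℝ) := {x | ∀ i, 0 ≤ x i ∧ x i ≤ 1}

/-- The part `Γ = ∂[0,1]^n \ (0,1]^n` of the boundary. -/
def lowerBoundary (n : ℕ) : Set (Fin n → ℝ) := frontier (closedCube n) \ halfOpenCube n

/-- The vector of partial derivatives at `x` of a function that is `C¹` on `(0,1]^n`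
(one-sided where `x i = 1`). -/
def cubeGrad {n : ℕ} (φ : (Fin n → ℝ) → ℝ) (x : Fin n → ℝ) : Fin n → ℝ :=
  fun i => fderivWithin ℝ φ (halfOpenCube n) x (Pi.single i 1)

/-- `w` has the viscosity subsolution property for `H(x, w, Dw) = 0` on `(0,1]^n`:
maxima are relative to `(0,1]^n`, and points with some `x i = 1` are included. -/
def ViscositySubOn {n : ℕ} (H : (Fin n → ℝ) → ℝ → (Fin n → ℝ) → ℝ)
    (w : (Fin n → ℝ) → ℝ) : Prop :=
  ∀ x ∈ halfOpenCube n, ∀ φ : (Fin n → ℝ) → ℝ, ContDiffOn ℝ 1 φ (halfOpenCube n) →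
    IsLocalMaxOn (fun y => w y - φ y) (halfOpenCube n) x → H x (w x) (cubeGrad φ x) ≤ 0

/-- `w` has the viscosity supersolution property for `H(x, w, Dw) = 0` on `(0,1]^n`. -/
def ViscositySuperOn {n : ℕ} (H : (Fin n → ℝ) → ℝ → (Fin n → ℝ) → ℝ)
    (w : (Fin n → ℝ) → ℝ) : Prop :=
  ∀ x ∈ halfOpenCube n, ∀ φ : (Fin n → ℝ) → ℝ, ContDiffOn ℝ 1 φ (halfOpenCube n) →
    IsLocalMinOn (fun y => w y - φ y) (halfOpenCube n) x → 0 ≤ H x (w x) (cubeGrad φ x)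

/-- The Hamiltonian `∏ᵢ (pᵢ)₊ - f(x)`. -/
def hamU {n : ℕ} (f : (Fin n → ℝ) → ℝ) (x : Fin n → ℝ) (_z : ℝ) (p : Fin n → ℝ) : ℝ :=
  (∏ i, max (p i) 0) - f x

/-- The Hamiltonian `∏ᵢ (z + n xᵢ pᵢ)₊ - f(x)`. -/
def hamW {n : ℕ} (f : (Fin n → ℝ) → ℝ) (x : Fin n → ℝ) (z : ℝ) (p : Fin n → ℝ) : ℝ :=
  (∏ i, max (z + n * x i * p i) 0) - f x

/-- Boundedness on `(0,1]^n`. -/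
def BoundedOnCube {n : ℕ} (w : (Fin n → ℝ) → ℝ) : Prop :=
  ∃ C : ℝ, ∀ x ∈ halfOpenCube n, |w x| ≤ C

/-- Bounded USC viscosity subsolution of `∏ᵢ (w + n xᵢ w_{xᵢ})₊ = f` on `(0,1]^n`. -/
def IsBoundedSubsolution {n : ℕ} (f w : (Fin n → ℝ) → ℝ) : Prop :=
  UpperSemicontinuousOn w (halfOpenCube n) ∧ BoundedOnCube w ∧ ViscositySubOn (hamW f) w

/-- Bounded LSC viscosity supersolution of `∏ᵢ (w + n xᵢ w_{xᵢ})₊ = f` on `(0,1]^n`. -/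
def IsBoundedSupersolution {n : ℕ} (f w : (Fin n → ℝ) → ℝ) : Prop :=
  LowerSemicontinuousOn w (halfOpenCube n) ∧ BoundedOnCube w ∧ ViscositySuperOn (hamW f) w

/-- Bounded viscosity solution of `∏ᵢ (w + n xᵢ w_{xᵢ})₊ = f` on `(0,1]^n`. -/
def IsBoundedSolution {n : ℕ} (f w : (Fin n → ℝ) → ℝ) : Prop :=
  IsBoundedSubsolution f w ∧ IsBoundedSupersolution f w

/-- `w + n xᵢ w_{xᵢ} ≥ 0` on `(0,1]^n` in the viscosity sense, for every `i`. -/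
def SatisfiesSlopeCondition {n : ℕ} (w : (Fin n → ℝ) → ℝ) : Prop :=
  ∀ i : Fin n, ViscositySuperOn (fun x z p => z + n * x i * p i) w

/-- Nondecreasing viscosity solution, continuous on `[0,1]^n`, of `∏ᵢ (u_{xᵢ})₊ = f` in
`(0,1]^n` with `u = 0` on `Γ`. -/
def IsNondecreasingSolution {n : ℕ} (f u : (Fin n → ℝ) → ℝ) : Prop :=
  ContinuousOn u (closedCube n) ∧ MonotoneOn u (closedCube n) ∧
    ViscositySubOn (hamU f) u ∧ ViscositySuperOn (hamU f) u ∧ ∀ x ∈ lowerBoundary n, u x = 0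

/-- The function `w` with `u(x) = n (x₁ ⋯ xₙ)^{1/n} w(x)` on `(0,1]^n`. -/
def profile {n : ℕ} (u : (Fin n → ℝ) → ℝ) (x : Fin n → ℝ) : ℝ :=
  u x / (n * (∏ i, x i) ^ (1 / (n : ℝ)))

end Nondominated

end

open Set

noncomputable section

namespace Nondominated

variable {n : ℕ}

/-! Comparison (`le_of_subsolution_of_supersolution`) doubles variables in the coordinates `log x
i`, where `x i * ∂ᵢ` becomes a plain derivative, so a quadratic penalty yields the same slope at
both points. The terms `η * log` tend to `-∞` at the lower boundary and replace a boundary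
condition. A gap between `w₁` and `w₂` raises every factor by `δ`; the slope condition makes the
factors of `w₂` nonnegative, so the positive parts do not absorb this gap. Superadditivity of
products then gives `f y + δ ^ n ≤ f x` at nearby points, against uniform continuity.

For (b), write `u = n * g * w` with `g` the geometric mean: the partials of `u` are `g / x i` times
the factors of (P3), and these weights have product 1. Monotonicity of `u` gives the slope
condition, a barrier `n * g * A` gives boundedness, and comparison does the rest. -/

/-! ### The cube and logarithmic test functions -/

lemma halfOpenCube_eq_pi : halfOpenCube n = Set.pi univ fun _ => Ioc (0 : ℝ) 1 := by
  ext x; simp [halfOpenCube]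

lemma closedCube_eq_pi : closedCube n = Set.pi univ fun _ => Icc (0 : ℝ) 1 := by
  ext x; simp [closedCube, Pi.le_def, forall_and]

lemma isCompact_closedCube : IsCompact (closedCube n) := by
  rw [closedCube_eq_pi]; exact isCompact_univ_pi fun _ => isCompact_Icc

lemma halfOpenCube_subset_closedCube : halfOpenCube n ⊆ closedCube n :=
  fun _ hx i => ⟨(hx i).1.le, (hx i).2⟩

lemma uniqueDiffOn_halfOpenCube : UniqueDiffOn ℝ (halfOpenCube n) := by
  rw [halfOpenCube_eq_pi]; exact UniqueDiffOn.univ_pi fun _ => uniqueDiffOn_Ioc 0 1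

lemma cubeGrad_eq_of_hasFDerivWithinAt {φ : (Fin n → ℝ) → ℝ} {φ' : (Fin n → ℝ) →L[ℝ] ℝ}
    {x : Fin n → ℝ} (h : HasFDerivWithinAt φ φ' (halfOpenCube n) x) (hx : x ∈ halfOpenCube n)
    (i : Fin n) : cubeGrad φ x i = φ' (Pi.single i 1) := by
  rw [cubeGrad, h.fderivWithin (uniqueDiffOn_halfOpenCube x hx)]

/-- A quadratic polynomial in the logarithms of the coordinates. -/
def logQuadratic (a b : ℝ) (c : Fin n → ℝ) (x : Fin n → ℝ) : ℝ :=
  ∑ i, (a / 2 * (Real.log (x i) - c i) ^ 2 + b * Real.log (x i))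

lemma contDiffOn_log_coord (i : Fin n) :
    ContDiffOn ℝ 1 (fun x : Fin n → ℝ => Real.log (x i)) (halfOpenCube n) :=
  ContDiffOn.log (contDiff_apply ℝ ℝ i).contDiffOn fun _ hx => (hx i).1.ne'

lemma contDiffOn_logQuadratic (a b : ℝ) (c : Fin n → ℝ) :
    ContDiffOn ℝ 1 (logQuadratic a b c) (halfOpenCube n) :=
  ContDiffOn.sum fun i _ =>
    (contDiffOn_const.mul (((contDiffOn_log_coord i).sub contDiffOn_const).pow 2)).add
      (contDiffOn_const.mul (contDiffOn_log_coord i))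

lemma hasFDerivAt_log_coord {x : Fin n → ℝ} (hx : x ∈ halfOpenCube n) (i : Fin n) :
    HasFDerivAt (fun y : Fin n → ℝ => Real.log (y i))
      ((x i)⁻¹ • ContinuousLinearMap.proj (R := ℝ) (φ := fun _ : Fin n => ℝ) i) x :=
  (Real.hasDerivAt_log (hx i).1.ne').comp_hasFDerivAt (f := fun y : Fin n → ℝ => y i) x
    (ContinuousLinearMap.proj (R := ℝ) (φ := fun _ : Fin n => ℝ) i).hasFDerivAt

lemma mul_cubeGrad_logQuadratic (a b : ℝ) (c : Fin n → ℝ) {x : Fin n → ℝ}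
    (hx : x ∈ halfOpenCube n) (i : Fin n) :
    x i * cubeGrad (logQuadratic a b c) x i = a * (Real.log (x i) - c i) + b := by
  have h : HasFDerivAt (logQuadratic a b c) _ x := HasFDerivAt.fun_sum fun i _ =>
    ((((hasFDerivAt_log_coord hx i).sub_const (c i)).pow 2).const_mul (a / 2)).add
      ((hasFDerivAt_log_coord hx i).const_mul b)
  rw [cubeGrad_eq_of_hasFDerivWithinAt h.hasFDerivWithinAt hx]
  have hxi := (hx i).1.ne'
  simp [Pi.single_apply, Finset.sum_add_distrib]
  field_simp

/-! ### Geometric mean and the change of unknown -/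

/-- The geometric mean of the coordinates. -/
def geomMean (x : Fin n → ℝ) : ℝ := (∏ i, x i) ^ (1 / (n : ℝ))

lemma prod_pos_of_mem {x : Fin n → ℝ} (hx : x ∈ halfOpenCube n) : 0 < ∏ i, x i :=
  Finset.prod_pos fun i _ => (hx i).1

lemma geomMean_pos {x : Fin n → ℝ} (hx : x ∈ halfOpenCube n) : 0 < geomMean x :=
  Real.rpow_pos_of_pos (prod_pos_of_mem hx) _

lemma geomMean_pow (hn : 1 ≤ n) {x : Fin n → ℝ} (hx : x ∈ halfOpenCube n) :
    geomMean x ^ n = ∏ i, x i := by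
  rw [geomMean, one_div, Real.rpow_inv_natCast_pow (prod_pos_of_mem hx).le (by omega)]

lemma geomMean_nonneg {x : Fin n → ℝ} (hx : x ∈ closedCube n) : 0 ≤ geomMean x :=
  Real.rpow_nonneg (Finset.prod_nonneg fun i _ => (hx i).1) _

lemma continuous_geomMean : Continuous (geomMean (n := n)) :=
  (continuous_finsetProd _ fun i _ => continuous_apply i).rpow_const
    fun _ => Or.inr (by positivity)

lemma contDiffOn_geomMean : ContDiffOn ℝ 1 (geomMean (n := n)) (halfOpenCube n) :=
  (contDiffOn_prod fun i _ => (contDiff_apply ℝ ℝ i).contDiffOn).rpow_const_of_ne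
    fun _ hx => (prod_pos_of_mem hx).ne'

lemma hasFDerivWithinAt_geomMean {x : Fin n → ℝ} (hx : x ∈ halfOpenCube n) :
    HasFDerivWithinAt geomMean (∑ i, (geomMean x / (n * x i)) •
      ContinuousLinearMap.proj (R := ℝ) (φ := fun _ : Fin n => ℝ) i) (halfOpenCube n) x := by
  have key : ∀ y ∈ halfOpenCube n,
      geomMean y = Real.exp (∑ i, Real.log (y i) * (1 / (n : ℝ))) := by
    intro y hy
    rw [geomMean, Real.rpow_def_of_pos (prod_pos_of_mem hy),
      Real.log_prod fun i _ => (hy i).1.ne', Finset.sum_mul]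
  have h := (HasFDerivAt.fun_sum (u := Finset.univ) fun i _ =>
    (hasFDerivAt_log_coord hx i).mul_const (1 / (n : ℝ))).exp
  refine (h.hasFDerivWithinAt.congr key (key x hx)).congr_fderiv ?_
  rw [← key x hx, Finset.smul_sum]
  refine Finset.sum_congr rfl fun i _ => ?_
  rw [smul_smul, smul_smul]
  congr 1
  rw [div_eq_mul_inv (geomMean x), mul_inv]; ring

lemma cubeGrad_geomMean_mul (hn : 1 ≤ n) {φ : (Fin n → ℝ) → ℝ}
    (hφ : ContDiffOn ℝ 1 φ (halfOpenCube n)) (c : ℝ) {x : Fin n → ℝ}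
    (hx : x ∈ halfOpenCube n) (i : Fin n) :
    cubeGrad (fun y => n * geomMean y * (φ y + c)) x i =
      geomMean x / x i * (φ x + c + n * x i * cubeGrad φ x i) := by
  have hd := ((hφ.differentiableOn (by norm_num)) x hx).hasFDerivWithinAt
  have h : HasFDerivWithinAt (fun y => n * geomMean y * (φ y + c)) _ _ x :=
    ((hasFDerivWithinAt_geomMean hx).const_mul (n : ℝ)).mul (hd.add_const c)
  rw [cubeGrad_eq_of_hasFDerivWithinAt h hx, cubeGrad]
  have hxi := (hx i).1.ne'
  have hn' : (n : ℝ) ≠ 0 := by positivity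
  simp [Pi.single_apply]
  field_simp
  ring

/-- The weights `geomMean x / x i` are positive, so they leave the positive parts, and their product
is `geomMean x ^ n / ∏ x i = 1`. -/
lemma hamU_eq_hamW (hn : 1 ≤ n) (f : (Fin n → ℝ) → ℝ) {φ : (Fin n → ℝ) → ℝ}
    (hφ : ContDiffOn ℝ 1 φ (halfOpenCube n)) (c z z' : ℝ) {x : Fin n → ℝ}
    (hx : x ∈ halfOpenCube n) (hz : z = φ x + c) :
    hamU f x z' (cubeGrad (fun y => n * geomMean y * (φ y + c)) x) =
      hamW f x z (cubeGrad φ x) := by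
  have hg := geomMean_pos hx
  simp only [hamU, hamW]
  congr 1
  have : ∀ i, max (cubeGrad (fun y => n * geomMean y * (φ y + c)) x i) 0 =
      geomMean x / x i * max (z + n * x i * cubeGrad φ x i) 0 := fun i => by
    rw [cubeGrad_geomMean_mul hn hφ c hx, hz,
      mul_max_of_nonneg _ _ (div_nonneg hg.le (hx i).1.le), mul_zero]
  rw [Finset.prod_congr rfl fun i _ => this i, Finset.prod_mul_distrib, Finset.prod_div_distrib,
    Finset.prod_const, Finset.card_univ, Fintype.card_fin, geomMean_pow hn hx,
    div_self (prod_pos_of_mem hx).ne', one_mul]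

/-- The slope of a test function touching a monotone function from below is nonnegative. -/
lemma cubeGrad_nonneg_of_monotone {u φ : (Fin n → ℝ) → ℝ} (hu : MonotoneOn u (closedCube n))
    (hφ : ContDiffOn ℝ 1 φ (halfOpenCube n)) {x : Fin n → ℝ} (hx : x ∈ halfOpenCube n)
    (hmin : IsLocalMinOn (fun y => u y - φ y) (halfOpenCube n) x) (i : Fin n) :
    0 ≤ cubeGrad φ x i := by
  have hd := ((hφ.differentiableOn (by norm_num)) x hx).hasFDerivWithinAt
  -- Only left difference quotients are used: when `x i = 1` the cube has no points to the right.
  have hline : HasDerivWithinAt (fun t : ℝ => Function.update x i t) (Pi.single i 1)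
      (Iic (x i)) (x i) := (hasDerivAt_update x i (x i)).hasDerivWithinAt
  have hupd : Function.update x i (x i) = x := Function.update_eq_self i x
  have hmem : ∀ t ∈ Ioc 0 (x i), Function.update x i t ∈ halfOpenCube n := by
    intro t ht j
    rcases eq_or_ne j i with rfl | hj
    · simpa using ⟨ht.1, ht.2.trans (hx j).2⟩
    · simpa [hj] using hx j
  have hc : HasDerivWithinAt (φ ∘ fun t : ℝ => Function.update x i t)
      (fderivWithin ℝ φ (halfOpenCube n) x (Pi.single i 1)) (Ioc 0 (x i)) (x i) :=
    HasFDerivWithinAt.comp_hasDerivWithinAt_of_eq (x i) hd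
      (hline.mono fun t ht => ht.2) hmem hupd.symm
  have htend : Filter.Tendsto (fun t : ℝ => Function.update x i t)
      (nhdsWithin (x i) (Ioc 0 (x i))) (nhdsWithin x (halfOpenCube n)) := by
    refine tendsto_nhdsWithin_iff.2 ⟨?_, Filter.eventually_of_mem self_mem_nhdsWithin hmem⟩
    have := (hline.mono (t := Iic (x i)) (s := Ioc 0 (x i)) fun t ht => ht.2).continuousWithinAt
    simpa [ContinuousWithinAt, hupd] using this
  have hslope := (hasDerivWithinAt_iff_tendsto_slope.1 hc)
  rw [Ioc_sdiff_right] at hslope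
  have hne : (nhdsWithin (x i) (Ioo 0 (x i))).NeBot := by
    rw [nhdsWithin_Ioo_eq_nhdsLT (hx i).1]; infer_instance
  refine ge_of_tendsto hslope ?_
  have h1 := (htend.mono_left (nhdsWithin_mono _ Ioo_subset_Ioc_self)).eventually hmin
  filter_upwards [h1, self_mem_nhdsWithin] with t ht hti
  have hmono : u (Function.update x i t) ≤ u x := by
    refine hu (halfOpenCube_subset_closedCube (hmem t (Ioo_subset_Ioc_self hti)))
      (halfOpenCube_subset_closedCube hx) ?_
    exact update_le_self_iff.2 hti.2.le
  rw [slope_def_field]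
  refine div_nonneg_of_nonpos ?_ (by linarith [hti.2])
  simp only [Function.comp, hupd]
  linarith

/-! ### Transfer of viscosity properties from `u` to its profile -/

lemma ViscositySubOn.congr {H : (Fin n → ℝ) → ℝ → (Fin n → ℝ) → ℝ} {w v : (Fin n → ℝ) → ℝ}
    (hv : ViscositySubOn H v) (h : EqOn w v (halfOpenCube n)) : ViscositySubOn H w := by
  intro x hx φ hφ hmax
  rw [h hx]
  refine hv x hx φ hφ ?_
  filter_upwards [hmax, self_mem_nhdsWithin] with y hy hyc
  rwa [h hx, h hyc] at hy

lemma ViscositySuperOn.congr {H : (Fin n → ℝ) → ℝ → (Fin n → ℝ) → ℝ} {w v : (Fin n → ℝ) → ℝ}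
    (hv : ViscositySuperOn H v) (h : EqOn w v (halfOpenCube n)) : ViscositySuperOn H w := by
  intro x hx φ hφ hmin
  rw [h hx]
  refine hv x hx φ hφ ?_
  filter_upwards [hmin, self_mem_nhdsWithin] with y hy hyc
  rwa [h hx, h hyc] at hy

lemma profile_eq (u : (Fin n → ℝ) → ℝ) (x : Fin n → ℝ) :
    profile u x = u x / (n * geomMean x) := rfl

lemma mul_profile (hn : 1 ≤ n) (u : (Fin n → ℝ) → ℝ) {x : Fin n → ℝ}
    (hx : x ∈ halfOpenCube n) : n * geomMean x * profile u x = u x := by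
  have := geomMean_pos hx
  have hn' : (0 : ℝ) < n := by exact_mod_cast hn
  rw [profile_eq]; field_simp

lemma contDiffOn_geomMean_mul {φ : (Fin n → ℝ) → ℝ}
    (hφ : ContDiffOn ℝ 1 φ (halfOpenCube n)) (c : ℝ) :
    ContDiffOn ℝ 1 (fun y => n * geomMean y * (φ y + c)) (halfOpenCube n) :=
  (contDiffOn_const.mul contDiffOn_geomMean).mul (hφ.add contDiffOn_const)

/-- Shifting `φ` by `profile u x - φ x` makes it touch the profile at `x`; multiplying by `n *
geomMean > 0` preserves the touching inequality. -/
lemma viscositySubOn_profile (hn : 1 ≤ n) {f u : (Fin n → ℝ) → ℝ}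
    (hu : ViscositySubOn (hamU f) u) : ViscositySubOn (hamW f) (profile u) := by
  intro x hx φ hφ hmax
  rw [← hamU_eq_hamW hn f hφ (profile u x - φ x) (profile u x) (u x) hx (by ring)]
  refine hu x hx _ (contDiffOn_geomMean_mul hφ _) ?_
  filter_upwards [hmax, self_mem_nhdsWithin] with y hy hyc
  have h := mul_nonneg (mul_nonneg n.cast_nonneg (geomMean_pos hyc).le) (sub_nonneg.2 hy)
  rw [← mul_profile hn u hyc, ← mul_profile hn u hx]
  linarith

lemma isLocalMinOn_of_profile (hn : 1 ≤ n) {u φ : (Fin n → ℝ) → ℝ} {x : Fin n → ℝ}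
    (hx : x ∈ halfOpenCube n)
    (hmin : IsLocalMinOn (fun y => profile u y - φ y) (halfOpenCube n) x) :
    IsLocalMinOn (fun y => u y - n * geomMean y * (φ y + (profile u x - φ x)))
      (halfOpenCube n) x := by
  filter_upwards [hmin, self_mem_nhdsWithin] with y hy hyc
  have h := mul_nonneg (mul_nonneg n.cast_nonneg (geomMean_pos hyc).le) (sub_nonneg.2 hy)
  rw [← mul_profile hn u hyc, ← mul_profile hn u hx]
  linarith

lemma viscositySuperOn_profile (hn : 1 ≤ n) {f u : (Fin n → ℝ) → ℝ}
    (hu : ViscositySuperOn (hamU f) u) : ViscositySuperOn (hamW f) (profile u) := by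
  intro x hx φ hφ hmin
  rw [← hamU_eq_hamW hn f hφ (profile u x - φ x) (profile u x) (u x) hx (by ring)]
  exact hu x hx _ (contDiffOn_geomMean_mul hφ _) (isLocalMinOn_of_profile hn hx hmin)

lemma satisfiesSlopeCondition_profile (hn : 1 ≤ n) {u : (Fin n → ℝ) → ℝ}
    (hu : MonotoneOn u (closedCube n)) : SatisfiesSlopeCondition (profile u) := by
  intro i x hx φ hφ hmin
  have h := cubeGrad_nonneg_of_monotone hu (contDiffOn_geomMean_mul hφ _) hx
    (isLocalMinOn_of_profile hn hx hmin) i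
  rw [cubeGrad_geomMean_mul hn hφ _ hx, add_sub_cancel] at h
  exact nonneg_of_mul_nonneg_right h (div_pos (geomMean_pos hx) (hx i).1)

lemma continuousOn_profile (hn : 1 ≤ n) {u : (Fin n → ℝ) → ℝ}
    (hu : ContinuousOn u (closedCube n)) : ContinuousOn (profile u) (halfOpenCube n) :=
  (hu.mono halfOpenCube_subset_closedCube).div
    (continuous_const.mul continuous_geomMean).continuousOn fun x hx =>
      mul_ne_zero (by exact_mod_cast (by omega : n ≠ 0)) (geomMean_pos hx).ne'

/-! ### Boundedness of the profile by a barrier -/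

lemma mem_lowerBoundary_of_eq_zero {x : Fin n → ℝ} (hx : x ∈ closedCube n) {i : Fin n}
    (hi : x i = 0) : x ∈ lowerBoundary n := by
  have hnot : x ∉ interior (closedCube n) := by
    rw [closedCube_eq_pi, interior_pi_set finite_univ]
    intro h
    have := h i (mem_univ i)
    simp [hi] at this
  exact ⟨⟨subset_closure hx, hnot⟩, fun h => (h i).1.ne' hi⟩

lemma exists_eq_zero_of_not_mem {x : Fin n → ℝ} (hx : x ∈ closedCube n)
    (h : x ∉ halfOpenCube n) : ∃ i, x i = 0 := by
  by_contra! hne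
  exact h fun i => ⟨lt_of_le_of_ne (hx i).1 (hne i).symm, (hx i).2⟩

lemma IsNondecreasingSolution.nonneg (hn : 1 ≤ n) {f u : (Fin n → ℝ) → ℝ}
    (hu : IsNondecreasingSolution f u) {x : Fin n → ℝ} (hx : x ∈ closedCube n) : 0 ≤ u x := by
  have h0 : (0 : Fin n → ℝ) ∈ closedCube n := fun _ => by simp
  rw [← hu.2.2.2.2 0 (mem_lowerBoundary_of_eq_zero h0 (i := ⟨0, hn⟩) rfl)]
  exact hu.2.1 h0 hx fun i => (hx i).1

/-- A solution vanishing on the lower boundary lies below a smooth strict supersolution. -/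
lemma IsNondecreasingSolution.le_geomMean (hn : 1 ≤ n) {f u : (Fin n → ℝ) → ℝ}
    (hu : IsNondecreasingSolution f u) {A : ℝ} (hA : 0 ≤ A)
    (hf : ∀ x ∈ closedCube n, f x < A ^ n) {x : Fin n → ℝ} (hx : x ∈ closedCube n) :
    u x ≤ n * geomMean x * A := by
  have hcont : ContinuousOn (fun y => u y - n * geomMean y * (0 + A)) (closedCube n) :=
    hu.1.sub ((continuous_const.mul continuous_geomMean).mul continuous_const).continuousOn
  obtain ⟨z, hz, hmax⟩ := isCompact_closedCube.exists_isMaxOn ⟨x, hx⟩ hcont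
  have hle : u z - n * geomMean z * (0 + A) ≤ 0 := by
    by_cases hzc : z ∈ halfOpenCube n
    · exfalso
      -- The barrier corresponds to the constant profile `A`, for which (P3) reads `A ^ n - f > 0`;
      -- it cannot touch a subsolution.
      have hφ : ContDiffOn ℝ 1 (fun _ : Fin n → ℝ => (0 : ℝ)) (halfOpenCube n) :=
        contDiffOn_const
      have h := hu.2.2.1 z hzc _ (contDiffOn_geomMean_mul hφ A)
        ((hmax.on_subset halfOpenCube_subset_closedCube).localize)
      rw [hamU_eq_hamW hn f hφ A A (u z) hzc (by ring)] at h
      have h0 : cubeGrad (fun _ : Fin n → ℝ => (0 : ℝ)) z = 0 := by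
        ext i; simp [cubeGrad]
      simp only [hamW, h0, Pi.zero_apply, mul_zero, add_zero, max_eq_left hA, Finset.prod_const,
        Finset.card_univ, Fintype.card_fin] at h
      linarith [hf z hz]
    · obtain ⟨i, hi⟩ := exists_eq_zero_of_not_mem hz hzc
      rw [hu.2.2.2.2 z (mem_lowerBoundary_of_eq_zero hz hi)]
      have := geomMean_nonneg hz
      have : 0 ≤ n * geomMean z * (0 + A) := by positivity
      linarith
  have := hmax hx
  simp only [mem_ofPred_eq, zero_add] at this hle
  linarith

lemma IsNondecreasingSolution.boundedOnCube_profile (hn : 1 ≤ n) {f u : (Fin n → ℝ) → ℝ}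
    (hf : ContinuousOn f (closedCube n)) (hu : IsNondecreasingSolution f u) :
    BoundedOnCube (profile u) := by
  obtain ⟨M, hM⟩ := isCompact_closedCube.exists_bound_of_continuousOn hf
  have hM' : ∀ x ∈ closedCube n, f x < (|M| + 1) ^ n := fun x hx => calc
    f x ≤ |f x| := le_abs_self _
    _ ≤ |M| := (hM x hx).trans (le_abs_self M)
    _ < |M| + 1 := lt_add_one _
    _ ≤ (|M| + 1) ^ n := le_self_pow₀ (by linarith [abs_nonneg M]) (by omega)
  refine ⟨|M| + 1, fun x hx => ?_⟩
  have hx' := halfOpenCube_subset_closedCube hx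
  have hpos : 0 < n * geomMean x :=
    mul_pos (by exact_mod_cast hn) (geomMean_pos hx)
  rw [profile_eq, abs_of_nonneg (div_nonneg (hu.nonneg hn hx') hpos.le), div_le_iff₀' hpos]
  exact hu.le_geomMean hn (by positivity) hM' hx'

/-! ### Doubling of variables and comparison -/

/-- The doubled functional of the comparison argument, in logarithmic coordinates. -/
def doubled (w₁ w₂ : (Fin n → ℝ) → ℝ) (a η : ℝ) (p : (Fin n → ℝ) × (Fin n → ℝ)) : ℝ :=
  w₁ p.1 - w₂ p.2 - ∑ i, (a / 2 * (Real.log (p.1 i) - Real.log (p.2 i)) ^ 2 -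
    η * Real.log (p.1 i) - η * Real.log (p.2 i))

lemma doubled_eq_sub_left (w₁ w₂ : (Fin n → ℝ) → ℝ) (a η : ℝ) (x y : Fin n → ℝ) :
    doubled w₁ w₂ a η (x, y) = (w₁ x - logQuadratic a (-η) (fun i => Real.log (y i)) x) +
      (-w₂ y + ∑ i, η * Real.log (y i)) := by
  simp only [doubled, logQuadratic, Finset.sum_sub_distrib, Finset.sum_add_distrib, neg_mul,
    Finset.sum_neg_distrib]
  ring

lemma doubled_eq_sub_right (w₁ w₂ : (Fin n → ℝ) → ℝ) (a η : ℝ) (x y : Fin n → ℝ) :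
    doubled w₁ w₂ a η (x, y) = -(w₂ y - logQuadratic (-a) η (fun i => Real.log (x i)) y) +
      (w₁ x + ∑ i, η * Real.log (x i)) := by
  have h : ∀ i, -a / 2 * (Real.log (y i) - Real.log (x i)) ^ 2 =
      -(a / 2 * (Real.log (x i) - Real.log (y i)) ^ 2) := fun i => by ring
  simp only [doubled, logQuadratic, h, Finset.sum_sub_distrib, Finset.sum_add_distrib,
    Finset.sum_neg_distrib]
  ring

lemma log_nonpos_of_mem {x : Fin n → ℝ} (hx : x ∈ halfOpenCube n) (i : Fin n) :
    Real.log (x i) ≤ 0 := Real.log_nonpos (hx i).1.le (hx i).2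

lemma doubled_summand_nonneg {a η : ℝ} (ha : 0 ≤ a) (hη : 0 ≤ η) {x y : Fin n → ℝ}
    (hx : x ∈ halfOpenCube n) (hy : y ∈ halfOpenCube n) (i : Fin n) :
    0 ≤ a / 2 * (Real.log (x i) - Real.log (y i)) ^ 2 -
      η * Real.log (x i) - η * Real.log (y i) := by
  have h1 := mul_nonneg_of_nonpos_of_nonpos (neg_nonpos.2 hη) (log_nonpos_of_mem hx i)
  have h2 := mul_nonneg_of_nonpos_of_nonpos (neg_nonpos.2 hη) (log_nonpos_of_mem hy i)
  have h3 : 0 ≤ a / 2 * (Real.log (x i) - Real.log (y i)) ^ 2 := by positivity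
  linarith

lemma doubled_le_sub_summand (w₁ w₂ : (Fin n → ℝ) → ℝ) {a η : ℝ} (ha : 0 ≤ a) (hη : 0 ≤ η)
    {x y : Fin n → ℝ} (hx : x ∈ halfOpenCube n) (hy : y ∈ halfOpenCube n) (i : Fin n) :
    doubled w₁ w₂ a η (x, y) ≤ w₁ x - w₂ y - (a / 2 * (Real.log (x i) - Real.log (y i)) ^ 2 -
      η * Real.log (x i) - η * Real.log (y i)) :=
  sub_le_sub_left (Finset.single_le_sum (f := fun i =>
    a / 2 * (Real.log (x i) - Real.log (y i)) ^ 2 - η * Real.log (x i) - η * Real.log (y i))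
    (fun j _ => doubled_summand_nonneg ha hη hx hy j) (Finset.mem_univ i)) _

lemma upperSemicontinuousOn_doubled {w₁ w₂ : (Fin n → ℝ) → ℝ}
    (h₁ : UpperSemicontinuousOn w₁ (halfOpenCube n))
    (h₂ : LowerSemicontinuousOn w₂ (halfOpenCube n)) (a η : ℝ) :
    UpperSemicontinuousOn (doubled w₁ w₂ a η) (halfOpenCube n ×ˢ halfOpenCube n) := by
  have hneg : UpperSemicontinuousOn (fun y => -w₂ y) (halfOpenCube n) :=
    continuous_neg.comp_lowerSemicontinuousOn_antitone h₂ fun _ _ h => neg_le_neg h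
  have hlog₁ : ∀ i, ContinuousOn (fun p : (Fin n → ℝ) × (Fin n → ℝ) => Real.log (p.1 i))
      (halfOpenCube n ×ˢ halfOpenCube n) := fun i =>
    ContinuousOn.log (by fun_prop) fun p hp => (hp.1 i).1.ne'
  have hlog₂ : ∀ i, ContinuousOn (fun p : (Fin n → ℝ) × (Fin n → ℝ) => Real.log (p.2 i))
      (halfOpenCube n ×ˢ halfOpenCube n) := fun i =>
    ContinuousOn.log (by fun_prop) fun p hp => (hp.2 i).1.ne'
  have hc : ContinuousOn (fun p : (Fin n → ℝ) × (Fin n → ℝ) =>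
      -∑ i, (a / 2 * (Real.log (p.1 i) - Real.log (p.2 i)) ^ 2 -
        η * Real.log (p.1 i) - η * Real.log (p.2 i))) (halfOpenCube n ×ˢ halfOpenCube n) :=
    (continuousOn_finsetSum _ fun i _ =>
      (((continuousOn_const.mul (((hlog₁ i).sub (hlog₂ i)).pow 2)).sub
        (continuousOn_const.mul (hlog₁ i))).sub (continuousOn_const.mul (hlog₂ i)))).neg
  have hw₁ := h₁.comp (g := Prod.fst) continuous_fst.continuousOn
    (fun p (hp : p ∈ halfOpenCube n ×ˢ halfOpenCube n) => hp.1)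
  have hw₂ := hneg.comp (g := Prod.snd) continuous_snd.continuousOn
    (fun p (hp : p ∈ halfOpenCube n ×ˢ halfOpenCube n) => hp.2)
  have h := (hw₁.add hw₂).add hc.upperSemicontinuousOn
  have e : doubled w₁ w₂ a η = _ := funext fun p => (congrArg (· - _) (sub_eq_add_neg _ _)).trans
    (sub_eq_add_neg _ _)
  rw [e]
  exact h

lemma exists_isMaxOn_doubled {w₁ w₂ : (Fin n → ℝ) → ℝ}
    (h₁ : UpperSemicontinuousOn w₁ (halfOpenCube n))
    (h₂ : LowerSemicontinuousOn w₂ (halfOpenCube n))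
    (hb₁ : BoundedOnCube w₁) (hb₂ : BoundedOnCube w₂) {a η : ℝ} (ha : 0 ≤ a) (hη : 0 < η)
    {x₀ : Fin n → ℝ} (hx₀ : x₀ ∈ halfOpenCube n) :
    ∃ x ∈ halfOpenCube n, ∃ y ∈ halfOpenCube n,
      IsMaxOn (doubled w₁ w₂ a η) (halfOpenCube n ×ˢ halfOpenCube n) (x, y) := by
  obtain ⟨C₁, hC₁⟩ := hb₁
  obtain ⟨C₂, hC₂⟩ := hb₂
  set m := doubled w₁ w₂ a η (x₀, x₀) with hm
  -- Where the functional is at least `m`, each `-η * log` is at most `C₁ + C₂ - m`, so all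
  -- coordinates are at least `r`.
  set r := Real.exp ((m - C₁ - C₂) / η) with hr
  set K : Set (Fin n → ℝ) := Set.pi univ fun _ => Icc r 1 with hK
  have hKc : IsCompact K := isCompact_univ_pi fun _ => isCompact_Icc
  have hKsub : K ⊆ halfOpenCube n := fun x hx i =>
    ⟨(Real.exp_pos _).trans_le (hx i (mem_univ i)).1, (hx i (mem_univ i)).2⟩
  have hmem : ∀ x ∈ halfOpenCube n, ∀ y ∈ halfOpenCube n,
      m ≤ doubled w₁ w₂ a η (x, y) → x ∈ K ∧ y ∈ K := by
    intro x hx y hy hle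
    have key : ∀ i, (m - C₁ - C₂) / η ≤ Real.log (x i) ∧ (m - C₁ - C₂) / η ≤ Real.log (y i) := by
      intro i
      have h := doubled_le_sub_summand w₁ w₂ ha hη.le hx hy i
      have e1 := (abs_le.1 (hC₁ x hx)).2
      have e2 := (abs_le.1 (hC₂ y hy)).1
      have h1 := mul_nonneg_of_nonpos_of_nonpos (neg_nonpos.2 hη.le) (log_nonpos_of_mem hx i)
      have h2 := mul_nonneg_of_nonpos_of_nonpos (neg_nonpos.2 hη.le) (log_nonpos_of_mem hy i)
      have h3 : 0 ≤ a / 2 * (Real.log (x i) - Real.log (y i)) ^ 2 := by positivity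
      constructor <;> rw [div_le_iff₀' hη] <;> linarith
    exact ⟨fun i _ => ⟨(Real.le_log_iff_exp_le (hx i).1).1 (key i).1, (hx i).2⟩,
      fun i _ => ⟨(Real.le_log_iff_exp_le (hy i).1).1 (key i).2, (hy i).2⟩⟩
  have h₀ := hmem x₀ hx₀ x₀ hx₀ le_rfl
  obtain ⟨⟨x, y⟩, hxy, hmax⟩ := ((upperSemicontinuousOn_doubled h₁ h₂ a η).mono
    (prod_mono hKsub hKsub)).exists_isMaxOn ⟨(x₀, x₀), h₀⟩ (hKc.prod hKc)
  refine ⟨x, hKsub hxy.1, y, hKsub hxy.2, fun q hq => ?_⟩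
  by_cases hqm : m ≤ doubled w₁ w₂ a η q
  · exact hmax (hmem q.1 hq.1 q.2 hq.2 hqm)
  · exact (not_le.1 hqm).le.trans (hmax h₀)

/-- The derivative of `log` is at least 1 on `(0,1]`; closeness in logarithms thus gives closeness
in the cube. -/
lemma abs_sub_le_abs_log_sub_log {s t : ℝ} (hs : 0 < s ∧ s ≤ 1) (ht : 0 < t ∧ t ≤ 1) :
    |s - t| ≤ |Real.log s - Real.log t| := by
  have key : ∀ {s t : ℝ}, 0 < s → s ≤ t → t ≤ 1 → t - s ≤ Real.log t - Real.log s := by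
    intro s t hs hst ht1
    have ht := hs.trans_le hst
    have h := Real.log_le_sub_one_of_pos (div_pos hs ht)
    rw [Real.log_div hs.ne' ht.ne', div_sub_one ht.ne'] at h
    have h2 : (s - t) / t ≤ s - t := by
      rw [div_le_iff₀ ht]
      nlinarith
    linarith
  rcases le_total s t with h | h
  · rw [abs_sub_comm, abs_sub_comm (Real.log s)]
    exact (abs_of_nonneg (sub_nonneg.2 h)).trans_le ((key hs.1 h ht.2).trans (le_abs_self _))
  · exact (abs_of_nonneg (sub_nonneg.2 h)).trans_le ((key ht.1 h hs.2).trans (le_abs_self _))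

/-- At a maximum of the doubled functional with a positive gap, the source term drops by a fixed
amount. -/
lemma add_pow_le_of_isMaxOn_doubled (hn : 1 ≤ n) {f w₁ w₂ : (Fin n → ℝ) → ℝ}
    (h₁ : ViscositySubOn (hamW f) w₁) (h₂ : ViscositySuperOn (hamW f) w₂)
    (hs : SatisfiesSlopeCondition w₂) {a η δ : ℝ} {x y : Fin n → ℝ}
    (hx : x ∈ halfOpenCube n) (hy : y ∈ halfOpenCube n)
    (hmax : IsMaxOn (doubled w₁ w₂ a η) (halfOpenCube n ×ˢ halfOpenCube n) (x, y))
    (hδ : 0 ≤ δ) (hgap : w₂ y + δ + 2 * n * η ≤ w₁ x) : f y + δ ^ n ≤ f x := by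
  have hmax₁ : IsLocalMaxOn (fun z => w₁ z - logQuadratic a (-η) (fun i => Real.log (y i)) z)
      (halfOpenCube n) x := by
    refine IsMaxOn.localize fun z hz => ?_
    have h := hmax (mk_mem_prod hz hy)
    simp only [mem_ofPred_eq, doubled_eq_sub_left] at h ⊢
    linarith
  have hmin₂ : IsLocalMinOn (fun z => w₂ z - logQuadratic (-a) η (fun i => Real.log (x i)) z)
      (halfOpenCube n) y := by
    refine IsMinOn.localize fun z hz => ?_
    have h := hmax (mk_mem_prod hx hz)
    simp only [mem_ofPred_eq, doubled_eq_sub_right] at h ⊢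
    linarith
  have e₁ := h₁ x hx _ (contDiffOn_logQuadratic _ _ _) hmax₁
  have e₂ := h₂ y hy _ (contDiffOn_logQuadratic _ _ _) hmin₂
  have e₃ := fun i => hs i y hy _ (contDiffOn_logQuadratic _ _ _) hmin₂
  simp only [hamW, mul_assoc, mul_cubeGrad_logQuadratic _ _ _ hx,
    mul_cubeGrad_logQuadratic _ _ _ hy] at e₁ e₂ e₃
  have hprod := Finset.prod_add_prod_le (R := ℝ) (s := Finset.univ) (i := ⟨0, hn⟩)
    (g := fun i => max (w₂ y + n * (-a * (Real.log (y i) - Real.log (x i)) + η)) 0)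
    (h := fun _ => δ)
    (f := fun i => max (w₁ x + n * (a * (Real.log (x i) - Real.log (y i)) + -η)) 0)
  have hle : ∀ i, max (w₂ y + n * (-a * (Real.log (y i) - Real.log (x i)) + η)) 0 + δ ≤
      max (w₁ x + n * (a * (Real.log (x i) - Real.log (y i)) + -η)) 0 := by
    intro i
    -- The slope condition removes the positive part at `y`; the penalty slopes cancel, and the `η`
    -- terms cost `2 * n * η`.
    rw [max_eq_left (e₃ i)]
    exact le_max_of_le_left (by linarith)
  have h := hprod (Finset.mem_univ _) (hle _)
    (fun i _ _ => (le_add_of_nonneg_right hδ).trans (hle i))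
    (fun i _ _ => (le_add_of_nonneg_left (le_max_right _ _)).trans (hle i))
    (fun i _ => le_max_right _ _) (fun _ _ => hδ)
  simp only [Finset.prod_const, Finset.card_univ, Fintype.card_fin] at h
  linarith

theorem le_of_subsolution_of_supersolution (hn : 1 ≤ n) {f w₁ w₂ : (Fin n → ℝ) → ℝ}
    (hf : ContinuousOn f (closedCube n)) (h₁ : IsBoundedSubsolution f w₁)
    (h₂ : IsBoundedSupersolution f w₂) (hs : SatisfiesSlopeCondition w₂)
    {x₀ : Fin n → ℝ} (hx₀ : x₀ ∈ halfOpenCube n) : w₁ x₀ ≤ w₂ x₀ := by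
  by_contra! hlt
  set d := w₁ x₀ - w₂ x₀ with hd
  have hd0 : 0 < d := sub_pos.2 hlt
  set L := ∑ i, -Real.log (x₀ i) with hL
  have hL0 : 0 ≤ L := Finset.sum_nonneg fun i _ => neg_nonneg.2 (log_nonpos_of_mem hx₀ i)
  have hn0 : (0 : ℝ) ≤ n := n.cast_nonneg
  -- The `η` terms cost `2 * η * L` at `(x₀, x₀)` and `2 * n * η` in the slopes; half of `d` must
  -- survive both.
  obtain ⟨η, hη, hηd⟩ : ∃ η : ℝ, 0 < η ∧ 2 * η * L + 2 * n * η ≤ d / 2 := by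
    refine ⟨d / (4 * (L + n + 1)), by positivity, ?_⟩
    have : 2 * (d / (4 * (L + n + 1))) * L + 2 * n * (d / (4 * (L + n + 1))) =
        d / 2 * ((L + n) / (L + n + 1)) := by field_simp; ring
    rw [this]
    exact mul_le_of_le_one_right (by positivity)
      ((div_le_one (by positivity)).2 (by linarith))
  obtain ⟨C₁, hC₁⟩ := h₁.2.1
  obtain ⟨C₂, hC₂⟩ := h₂.2.1
  have hC₁0 : 0 ≤ C₁ := (abs_nonneg _).trans (hC₁ x₀ hx₀)
  have hC₂0 : 0 ≤ C₂ := (abs_nonneg _).trans (hC₂ x₀ hx₀)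
  obtain ⟨ρ, hρ, hunif⟩ := Metric.uniformContinuousOn_iff.1
    (isCompact_closedCube.uniformContinuousOn_of_continuous hf) ((d / 2) ^ n) (by positivity)
  -- A logarithmic separation of `ρ` in one coordinate then costs `C₁ + C₂ + 1`, forcing a negative
  -- value, whereas the maximum is positive.
  set a := 2 * (C₁ + C₂ + 1) / ρ ^ 2 with ha
  have ha0 : 0 ≤ a := by positivity
  obtain ⟨x, hx, y, hy, hmax⟩ :=
    exists_isMaxOn_doubled h₁.1 h₂.1 h₁.2.1 h₂.2.1 ha0 hη hx₀
  have hval : d - 2 * η * L ≤ doubled w₁ w₂ a η (x, y) := by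
    have h : doubled w₁ w₂ a η (x₀, x₀) = d - 2 * η * L := by
      rw [hL, Finset.mul_sum, hd, doubled]
      congr 1
      exact Finset.sum_congr rfl fun i _ => by ring
    exact h ▸ hmax (mk_mem_prod hx₀ hx₀)
  have hnη : 0 ≤ 2 * n * η := by positivity
  have hgap : w₂ y + d / 2 + 2 * n * η ≤ w₁ x := by
    have h : doubled w₁ w₂ a η (x, y) ≤ w₁ x - w₂ y :=
      sub_le_self _ (Finset.sum_nonneg fun i _ => doubled_summand_nonneg ha0 hη.le hx hy i)
    linarith
  have hfxy := add_pow_le_of_isMaxOn_doubled hn h₁.2.2 h₂.2.2 hs hx hy hmax (by positivity) hgap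
  have hdist : dist x y < ρ := by
    refine (dist_pi_lt_iff hρ).2 fun i => ?_
    rw [Real.dist_eq]
    refine (abs_sub_le_abs_log_sub_log (hx i) (hy i)).trans_lt (abs_lt_of_sq_lt_sq ?_ hρ.le)
    by_contra! hge
    have h := doubled_le_sub_summand w₁ w₂ ha0 hη.le hx hy i
    have h1 := mul_nonneg_of_nonpos_of_nonpos (neg_nonpos.2 hη.le) (log_nonpos_of_mem hx i)
    have h2 := mul_nonneg_of_nonpos_of_nonpos (neg_nonpos.2 hη.le) (log_nonpos_of_mem hy i)
    have h3 : a / 2 * ρ ^ 2 ≤ a / 2 * (Real.log (x i) - Real.log (y i)) ^ 2 := by gcongr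
    have h4 : a / 2 * ρ ^ 2 = C₁ + C₂ + 1 := by rw [ha]; field_simp
    linarith [(abs_le.1 (hC₁ x hx)).2, (abs_le.1 (hC₂ y hy)).1]
  have hf' := hunif x (halfOpenCube_subset_closedCube hx) y (halfOpenCube_subset_closedCube hy)
    hdist
  rw [Real.dist_eq] at hf'
  linarith [le_abs_self (f x - f y)]

lemma IsNondecreasingSolution.isBoundedSolution_profile (hn : 1 ≤ n) {f u : (Fin n → ℝ) → ℝ}
    (hf : ContinuousOn f (closedCube n)) (hu : IsNondecreasingSolution f u) :
    IsBoundedSolution f (profile u) :=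
  have hb := hu.boundedOnCube_profile hn hf
  have hc := continuousOn_profile hn hu.1
  ⟨⟨hc.upperSemicontinuousOn, hb, viscositySubOn_profile hn hu.2.2.1⟩,
    hc.lowerSemicontinuousOn, hb, viscositySuperOn_profile hn hu.2.2.2.1⟩

lemma IsBoundedSolution.congr {f w v : (Fin n → ℝ) → ℝ} (hv : IsBoundedSolution f v)
    (h : EqOn w v (halfOpenCube n)) : IsBoundedSolution f w := by
  obtain ⟨⟨hu, ⟨C, hC⟩, hsub⟩, hl, -, hsup⟩ := hv
  have hb : BoundedOnCube w := ⟨C, fun x hx => h hx ▸ hC x hx⟩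
  refine ⟨⟨fun x hx r hr => ?_, hb, hsub.congr h⟩, fun x hx r hr => ?_, hb, hsup.congr h⟩
  · filter_upwards [hu x hx r ((h hx).symm.trans_lt hr), self_mem_nhdsWithin] with y hy hyc
    rwa [h hyc]
  · filter_upwards [hl x hx r (lt_of_lt_of_eq hr (h hx)), self_mem_nhdsWithin] with y hy hyc
    rwa [h hyc]

end Nondominated

end

theorem mainTheorem3 (n : ℕ) (hn : 1 ≤ n) (f : (Fin n → ℝ) → ℝ)
    (hf : ContinuousOn f (Nondominated.closedCube n))
    (hf0 : ∀ x ∈ Nondominated.closedCube n, 0 ≤ f x) :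
    (∀ w₁ w₂ : (Fin n → ℝ) → ℝ,
      Nondominated.IsBoundedSubsolution f w₁ →
      Nondominated.IsBoundedSupersolution f w₂ →
      Nondominated.SatisfiesSlopeCondition w₂ →
      ∀ x ∈ Nondominated.halfOpenCube n, w₁ x ≤ w₂ x) ∧
    (∀ u : (Fin n → ℝ) → ℝ, Nondominated.IsNondecreasingSolution f u →
      (∀ w : (Fin n → ℝ) → ℝ,
        (Nondominated.IsBoundedSolution f w ∧ Nondominated.SatisfiesSlopeCondition w) ↔
          Set.EqOn w (Nondominated.profile u) (Nondominated.halfOpenCube n)) ∧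
      (∀ w : (Fin n → ℝ) → ℝ, Nondominated.IsBoundedSolution f w →
        ∀ x ∈ Nondominated.halfOpenCube n, w x ≤ Nondominated.profile u x)) := by
  refine ⟨fun w₁ w₂ h₁ h₂ hs x hx =>
    Nondominated.le_of_subsolution_of_supersolution hn hf h₁ h₂ hs hx, fun u hu => ?_⟩
  have hsol := hu.isBoundedSolution_profile hn hf
  have hslope := Nondominated.satisfiesSlopeCondition_profile hn hu.2.1
  have hmax : ∀ w, Nondominated.IsBoundedSolution f w →
      ∀ x ∈ Nondominated.halfOpenCube n, w x ≤ Nondominated.profile u x := fun w hw x hx =>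
    Nondominated.le_of_subsolution_of_supersolution hn hf hw.1 hsol.2 hslope hx
  refine ⟨fun w => ⟨fun hw x hx => (hmax w hw.1 x hx).antisymm ?_, fun h => ?_⟩, hmax⟩
  -- Comparison with the roles exchanged, using the slope condition of `w` itself.
  · exact Nondominated.le_of_subsolution_of_supersolution hn hf hsol.1 hw.1.2 hw.2 hx
  · exact ⟨hsol.congr h, fun i => (hslope i).congr h⟩
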